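/- Consider a finite Markov decision process with state space $\mathcal S$, finite nonempty action space $\mathcal A$, transition probabilities $P_{ij}(u)$ and random costs $g(i,u)\in[0,1]$ almost surely; let $\alpha\in(0,1)$ be the discount factor. For a policy $\mu:\mathcal S\to\mathcal A$ let $J^\mu(i)=E[\sum_{k\ge0}\alpha^k g(x_k,\mu(x_k))\mid x_0=i]$, let $J^*=\min_\mu J^\mu$, and let $$(T_\mu J)(i)=E[g(i,\mu(i))]+\alpha\sum_j P_{ij}(\mu(i))J(j),\qquad (TJ)(i)=\min_u\Big[E[g(i,u)]+\alpha\sum_j P_{ij}(u)J(j)\Big].$$ Let $H\ge 2$, let $\Phi\in\mathbb R^{|\mathcal S|\times d}$ be a matrix whose rows $\phi(i)$ are feature vectors, let $\mathcal D\subseteq\mathcal S$ with $\operatorname{rank}\{\phi(i)\}_{i\in\mathcal D}=d$, let $\Phi_{\mathcal D}$ be the matrix of the rows of $\Phi$ indexed by $\mathcal D$, let $\mathcal P$ be the $0$-$1$ matrix that restricts a vector to the entries in $\mathcal D$, and put $\mathcal M=\Phi(\Phi_{\mathcal D}^\top\Phi_{\mathcal D})^{-1}\Phi_{\mathcal D}^\top\mathcal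 P$ and $\delta_2=\sup_\mu\|\mathcal M J^\mu-J^\mu\|_\infty$. Given a deterministic $V_0\in\mathbb R^{|\mathcal S|}$, step sizes $\gamma_k\ge0$ with $\sum_k\gamma_k=\infty$ and $\sum_k\gamma_k^2<\infty$, integers $\eta_k\ge 0$ with $\eta_k\to\infty$, and $\beta\in\mathbb R$ with $\|I-\beta\Phi_{\mathcal D}^\top\Phi_{\mathcal D}\|_2<1$, the algorithm does the following for $k=0,1,\dots$: 1. choose a policy $\mu_{k+1}$ with $T_{\mu_{k+1}}T^{H-1}V_k=T^HV_k$; 2. put $\hat J^{\mu_{k+1}}(i)=J^{\mu_{k+1}}(i)+w_k(i)$ for $i\in\mathcal D$, where $w_k$ is a random noise vector; 3. put $\theta_{k+1,0}=0$ and, for $\ell=1,\dots,\eta_k$, $\theta_{k+1,\ell}=\theta_{k+1,\ell-1}-\beta\nabla c_k(\theta_{k+1,\ell-1})$, where $c_k(\theta)=\frac12\sum_{i\in\mathcal D}\big((\Phi\theta)(i)-\hat J^{\mu_{k+1}}(i)\big)^2$; 4. put $V_{k+1}=(1-\gamma_k)V_k+\gamma_k\Phi\theta_{k+1,\eta_k}$.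 Let $(\mathcal F_k)$ be a filtration such that $w_k$ is $\mathcal F_{k+1}$-measurable and $\mu_{k+1}$ is $\mathcal F_k$-measurable (for example $\mathcal F_k=\sigma(w_0,\dots,w_{k-1})$, if $\mu_{k+1}$ is a measurable function of these). Assume that $E[w_k\mid\mathcal F_k]=0$ and $E[\|w_k\|_\infty\mid\mathcal F_k]\le\frac1{1-\alpha}$ for all $k$, and that there is a constant $C_w$ with $\|w_k\|_\infty\le C_w$ almost surely for all $k$. Then, almost surely, $$\limsup_{k\to\infty}\|V_k-J^*\|_\infty\le\frac1{1-\alpha^{H-1}}\Bigg[\delta_2+\frac{\alpha^{H-1}(1+\alpha)\big(\delta_2+\frac1{1-\alpha}\big)}{1-\alpha}\Bigg].$$ -/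

import Mathlib

open MeasureTheory ProbabilityTheory Filter

noncomputable section

namespace LookaheadGD

/-- A finite Markov decision process with random costs.  When action `u` is taken at state `i`,
`step i u` is the joint law of the pair (next state, incurred cost `g(i,u)`). -/
structure MDP (S A : Type*) [MeasurableSpace S] where
  step : S → A → Measure (S × ℝ)
  isProb : ∀ i u, IsProbabilityMeasure (step i u)

section Dynamics

variable {S A : Type*} [Fintype S] [MeasurableSpace S] [MeasurableSingletonClass S]

/-- All random costs lie in `[0,1]` with probability one. -/
def MDP.CostsInUnitInterval (M : MDP S A) : Prop :=
  ∀ i u, ∀ᵐ z ∂(M.step i u), 0 ≤ z.2 ∧ z.2 ≤ 1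

/-- The transition probability `P_{ij}(u)`. -/
def MDP.P (M : MDP S A) (i : S) (u : A) (j : S) : ℝ := (M.step i u).real {z | z.1 = j}

/-- The expected cost `E[g(i,u)]`. -/
def MDP.meanCost (M : MDP S A) (i : S) (u : A) : ℝ := ∫ z, z.2 ∂(M.step i u)

/-- The one-step kernel under the stationary policy `μ`. -/
def MDP.policyKernel (M : MDP S A) (μ : S → A) : Kernel S (S × ℝ) :=
  Kernel.ofFunOfCountable fun i => M.step i (μ i)

instance (M : MDP S A) (μ : S → A) : IsMarkovKernel (M.policyKernel μ) :=
  ⟨fun i => M.isProb i (μ i)⟩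

/-- The one-step kernel as a kernel from histories `z_0, …, z_n` that looks only at the state
component of `z_n`. -/
def MDP.historyKernel (M : MDP S A) (μ : S → A) (n : ℕ) :
    Kernel ((m : Finset.Iic n) → (fun _ : ℕ => S × ℝ) m) (S × ℝ) :=
  (M.policyKernel μ).comap (fun h => (h ⟨n, Finset.mem_Iic.2 le_rfl⟩).1) (by fun_prop)

instance (M : MDP S A) (μ : S → A) (n : ℕ) : IsMarkovKernel (M.historyKernel μ n) := by
  unfold MDP.historyKernel; infer_instance

/-- The law of the trajectory `z_0, z_1, …` of the controlled process started at `x_0 = i`: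
`z_0 = (i, 0)` and `z_{k+1} = (x_{k+1}, g(x_k, μ(x_k)))`. -/
def MDP.trajectoryLaw (M : MDP S A) (μ : S → A) (i : S) : Measure (ℕ → S × ℝ) :=
  Kernel.traj (X := fun _ : ℕ => S × ℝ) (M.historyKernel μ) 0 (fun _ => (i, 0))

/-- The value function `J^μ(i) = E[∑_k α^k g(x_k, μ(x_k)) | x_0 = i]`. -/
def MDP.value (M : MDP S A) (α : ℝ) (μ : S → A) (i : S) : ℝ :=
  ∫ z, ∑' k : ℕ, α ^ k * (z (k + 1)).2 ∂(M.trajectoryLaw μ i)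

/-- The optimal value function `J^* = min_μ J^μ` (there are finitely many policies). -/
def MDP.optValue [Fintype A] (M : MDP S A) (α : ℝ) (i : S) : ℝ :=
  ⨅ μ : S → A, M.value α μ i

/-- The operator `T_μ J = g_μ + α P_μ J`. -/
def MDP.Tpol (M : MDP S A) (α : ℝ) (μ : S → A) (J : S → ℝ) (i : S) : ℝ :=
  M.meanCost i (μ i) + α * ∑ j, M.P i (μ i) j * J j

/-- The Bellman optimality operator (a minimum over the finitely many actions). -/
def MDP.T [Fintype A] (M : MDP S A) (α : ℝ) (J : S → ℝ) (i : S) : ℝ :=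
  ⨅ u : A, (M.meanCost i u + α * ∑ j, M.P i u j * J j)

/-- `μ` is an `H`-step lookahead policy for `V`:  `T_μ T^{H-1} V = T^H V`. -/
def MDP.IsLookahead [Fintype A] (M : MDP S A) (α : ℝ) (H : ℕ) (V : S → ℝ) (μ : S → A) : Prop :=
  M.Tpol α μ ((M.T α)^[H - 1] V) = (M.T α)^[H] V

end Dynamics

section Features

variable {S : Type*} [Fintype S] [DecidableEq S] {d : ℕ}

/-- The matrix of zeros and ones restricting a vector on `S` to its entries in `D`. -/
def restr (D : Finset S) : Matrix D S ℝ := (1 : Matrix S S ℝ).submatrix (fun i : D => (i : S)) id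

/-- `Φ_D`: the rows of `Φ` indexed by `D`. -/
def featD (Φ : Matrix S (Fin d) ℝ) (D : Finset S) : Matrix D (Fin d) ℝ :=
  Φ.submatrix (fun i : D => (i : S)) id

/-- The matrix `Φ (Φ_Dᵀ Φ_D)⁻¹ Φ_Dᵀ 𝒫`, where `𝒫` is the restriction to `D`. -/
def projM (Φ : Matrix S (Fin d) ℝ) (D : Finset S) : Matrix S S ℝ :=
  Φ * ((featD Φ D).transpose * featD Φ D)⁻¹ * (featD Φ D).transpose * restr D

/-- The least-squares objective `c(θ; Ĵ) = ½ ∑_{i ∈ D} ((Φθ)(i) - Ĵ(i))²`. -/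
def lsCost (Φ : Matrix S (Fin d) ℝ) (D : Finset S) (Jhat : S → ℝ)
    (θ : EuclideanSpace ℝ (Fin d)) : ℝ :=
  1 / 2 * ∑ i ∈ D, (Φ.mulVec θ.ofLp i - Jhat i) ^ 2

/-- Gradient descent with step size `β` on the least-squares objective, started at `0`. -/
def gdIter (Φ : Matrix S (Fin d) ℝ) (D : Finset S) (β : ℝ) (Jhat : S → ℝ) :
    ℕ → EuclideanSpace ℝ (Fin d)
  | 0 => 0
  | l + 1 => gdIter Φ D β Jhat l - β • gradient (lsCost Φ D Jhat) (gdIter Φ D β Jhat l)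

/-- `δ₂ = sup_μ ‖𝓜 J^μ - J^μ‖_∞`, over the finitely many policies. -/
def delta2 {A : Type*} [MeasurableSpace S] [MeasurableSingletonClass S]
    (M : MDP S A) (α : ℝ) (Φ : Matrix S (Fin d) ℝ) (D : Finset S) : ℝ :=
  ⨆ μ : S → A, ‖(projM Φ D).mulVec (M.value α μ) - M.value α μ‖

/-- `(pol, V)` is a run of the algorithm for the noise realization `w`.
Here `pol k` is the policy `μ_{k+1}` that is computed from `V k`. -/
structure IsGDRun {A : Type*} [Fintype A] [MeasurableSpace S] [MeasurableSingletonClass S]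
    (M : MDP S A) (α : ℝ) (H : ℕ) (Φ : Matrix S (Fin d) ℝ) (D : Finset S) (β : ℝ)
    (γ : ℕ → ℝ) (η : ℕ → ℕ) (V0 : S → ℝ)
    (w : ℕ → S → ℝ) (pol : ℕ → S → A) (V : ℕ → S → ℝ) : Prop where
  init : V 0 = V0
  lookahead : ∀ k, M.IsLookahead α H (V k) (pol k)
  update : ∀ k, V (k + 1) = (1 - γ k) • V k +
    γ k • Φ.mulVec (gdIter Φ D β (M.value α (pol k) + w k) (η k)).ofLp

end Features

end LookaheadGD

end

/-!
Three facts combine to give the asymptotic bound.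

*Dynamic programming.* Computing the law of the state at each time from the Markov property turns
the value of a policy into the Neumann series `∑ α^k P_μ^k g_μ`, hence into a fixed point of `T_μ`
with entries in `[0, 1/(1-α)]`; the fixed point of the contraction `T` is the value of its greedy
policy and therefore equals `J^*` (`MDP.T_optValue`). Since `T^{H-1}` contracts by `α^{H-1}`, a
lookahead policy `μ` for `V` satisfies
`‖J^μ - J^*‖ ≤ α^{H-1} ‖V - J^*‖ + α^{H-1} (1+α) ‖V - J^*‖ / (1-α)`, the second term coming from
the Bellman residual (`MDP.norm_value_sub_optValue_le_of_isLookahead`).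

*Gradient descent.* The gradient step is affine with linear part `I - β Φ_Dᵀ Φ_D`, of norm less
than one, and the least-squares solution is its fixed point. As the values and the noise are
bounded, `Φ θ_{η_k}` differs from `𝓜 (J^μ + w_k)` by an error that vanishes as `η_k → ∞`
(`exists_norm_gdIter_sub_projM_le`).

*Noise.* The series `∑ γ_k w_k` converges almost surely, being an `L²`-bounded martingale
(`ae_exists_tendsto_sum_mul`). Adding `𝓜` applied to its tail to `V_k`, which changes `V_k` by a
vanishing amount, removes the noise and leaves `U_{k+1} = (1-γ_k) U_k + γ_k (𝓜 J^{μ_{k+1}} + e_k)`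
with `e_k → 0` (`IsGDRun.exists_vanishing_correction`).

Such an averaging recursion forgets its initial value (`eventually_lt_of_averaging`), so the error
`‖U_k - J^*‖` is asymptotically governed by `‖𝓜 J^μ - J^*‖ ≤ δ₂ + ‖J^μ - J^*‖`. It is used twice:
with `‖J^μ - J^*‖ ≤ 1/(1-α)` it gives `limsup ‖V_k - J^*‖ ≤ δ₂ + 1/(1-α)`; this bound is inserted
into the residual term of the lookahead estimate, whose other term is absorbed by the contraction
factor `1 - α^{H-1}`.
-/

open scoped Topology

namespace LookaheadGD

/-! ### Transition probabilities, costs and the value of a policy -/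

section Dynamics

variable {S A : Type*} [MeasurableSpace S]

instance (M : MDP S A) (i : S) (u : A) : IsProbabilityMeasure (M.step i u) := M.isProb i u

namespace MDP

lemma P_nonneg (M : MDP S A) (i : S) (u : A) (j : S) : 0 ≤ M.P i u j := measureReal_nonneg

lemma meanCost_nonneg {M : MDP S A} (hM : M.CostsInUnitInterval) (i : S) (u : A) :
    0 ≤ M.meanCost i u :=
  integral_nonneg_of_ae ((hM i u).mono fun _ h => h.1)

lemma meanCost_le_one {M : MDP S A} (hM : M.CostsInUnitInterval) (i : S) (u : A) :
    M.meanCost i u ≤ 1 := by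
  have h := integral_mono_of_nonneg (μ := M.step i u) (f := fun z => z.2) (g := fun _ => 1)
    ((hM i u).mono fun _ h => h.1) (integrable_const _) ((hM i u).mono fun _ h => h.2)
  simpa [meanCost] using h

lemma abs_meanCost_le_one {M : MDP S A} (hM : M.CostsInUnitInterval) (i : S) (u : A) :
    |M.meanCost i u| ≤ 1 :=
  abs_le.2 ⟨by linarith [M.meanCost_nonneg hM i u], M.meanCost_le_one hM i u⟩

variable [Fintype S]

lemma T_le_Tpol [Fintype A] (M : MDP S A) (α : ℝ) (μ : S → A) (J : S → ℝ) : M.T α J ≤ M.Tpol α μ J :=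
  fun i => ciInf_le (Set.finite_range _).bddBelow (μ i)

lemma exists_Tpol_eq_T [Fintype A] [Nonempty A] (M : MDP S A) (α : ℝ) (J : S → ℝ) :
    ∃ μ : S → A, M.Tpol α μ J = M.T α J := by
  choose μ hμ using fun i => exists_eq_ciInf_of_finite
    (f := fun u : A => M.meanCost i u + α * ∑ j, M.P i u j * J j)
  exact ⟨μ, funext hμ⟩

lemma Tpol_mono (M : MDP S A) {α : ℝ} (h0 : 0 < α) (μ : S → A) {J J' : S → ℝ} (h : J ≤ J') :
    M.Tpol α μ J ≤ M.Tpol α μ J' := fun _ =>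
  add_le_add_right (mul_le_mul_of_nonneg_left (Finset.sum_le_sum fun j _ =>
    mul_le_mul_of_nonneg_left (h j) (M.P_nonneg _ _ _)) h0.le) _

variable [MeasurableSingletonClass S]

instance (M : MDP S A) (μ : S → A) (i : S) : IsProbabilityMeasure (M.trajectoryLaw μ i) := by
  unfold MDP.trajectoryLaw; infer_instance

lemma integral_fst_step (M : MDP S A) (i : S) (u : A) (f : S → ℝ) :
    ∫ z, f z.1 ∂(M.step i u) = ∑ j, M.P i u j * f j := by
  have hf : Measurable f := measurable_of_finite f
  rw [← integral_map (φ := Prod.fst) (f := f) measurable_fst.aemeasurable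
    hf.aestronglyMeasurable]
  have := Measure.isProbabilityMeasure_map (μ := M.step i u) (f := Prod.fst)
    measurable_fst.aemeasurable
  rw [integral_fintype .of_finite]
  refine Finset.sum_congr rfl fun j _ => ?_
  rw [map_measureReal_apply measurable_fst (measurableSet_singleton j)]
  rfl

lemma sum_P (M : MDP S A) (i : S) (u : A) : ∑ j, M.P i u j = 1 := by
  simpa using (M.integral_fst_step i u fun _ => 1).symm

lemma abs_sum_P_mul_le (M : MDP S A) (i : S) (u : A) (f : S → ℝ) {C : ℝ}
    (hf : ∀ j, |f j| ≤ C) : |∑ j, M.P i u j * f j| ≤ C :=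
  calc |∑ j, M.P i u j * f j| ≤ ∑ j, |M.P i u j * f j| := Finset.abs_sum_le_sum_abs _ _
    _ ≤ ∑ j, M.P i u j * C := by
        refine Finset.sum_le_sum fun j _ => ?_
        rw [abs_mul, abs_of_nonneg (M.P_nonneg i u j)]
        exact mul_le_mul_of_nonneg_left (hf j) (M.P_nonneg i u j)
    _ = C := by rw [← Finset.sum_mul, M.sum_P, one_mul]

/-- The Markov property at a fixed time: given the current state, the next step is drawn from the
one-step kernel. -/
lemma map_trajectoryLaw_succ (M : MDP S A) (μ : S → A) (i : S) (n : ℕ) :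
    (M.trajectoryLaw μ i).map (fun z => z (n + 1)) =
      ((M.trajectoryLaw μ i).map (fun z => (z n).1)).bind (M.policyKernel μ) := by
  have h := Kernel.partialTraj_compProd_eq_map_traj (X := fun _ : ℕ => S × ℝ)
    (κ := M.historyKernel μ) (Nat.zero_le n) (x₀ := fun _ => (i, 0))
  have h2 := congrArg (fun ν => ν.map Prod.snd) h
  rw [Measure.map_map (by fun_prop) (by fun_prop), ← Measure.snd, Measure.snd_compProd,
    ← Kernel.traj_map_frestrictLe_apply] at h2
  refine h2.symm.trans ?_
  ext s hs
  rw [Measure.bind_apply hs (Kernel.aemeasurable _), Measure.bind_apply hs (Kernel.aemeasurable _),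
    lintegral_map (Kernel.measurable_coe _ hs) (by fun_prop),
    lintegral_map (Kernel.measurable_coe _ hs) (by fun_prop)]
  rfl

lemma map_trajectoryLaw_zero (M : MDP S A) (μ : S → A) (i : S) :
    (M.trajectoryLaw μ i).map (fun z => (z 0).1) = Measure.dirac i := by
  have h := Kernel.traj_map_frestrictLe_apply (X := fun _ : ℕ => S × ℝ)
    (κ := M.historyKernel μ) 0 0 (fun _ => (i, 0))
  rw [Kernel.partialTraj_self, Kernel.id_apply] at h
  have h2 := congrArg (fun ν => ν.map
    (fun h : (m : Finset.Iic 0) → S × ℝ => (h ⟨0, Finset.mem_Iic.2 le_rfl⟩).1)) h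
  rw [Measure.map_map (by fun_prop) (by fun_prop), Measure.map_dirac' (by fun_prop)] at h2
  exact h2

lemma ae_trajectoryLaw_succ (M : MDP S A) (μ : S → A) (i : S) (n : ℕ) {p : S × ℝ → Prop}
    (hp : MeasurableSet {z | p z}) (h : ∀ j, ∀ᵐ z ∂(M.step j (μ j)), p z) :
    ∀ᵐ z ∂(M.trajectoryLaw μ i), p (z (n + 1)) := by
  have hm : Measurable fun z : ℕ → S × ℝ => z (n + 1) := by fun_prop
  rw [← ae_map_iff hm.aemeasurable hp, M.map_trajectoryLaw_succ]
  exact Measure.ae_comp_of_ae_ae hp (ae_of_all _ h)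

lemma integral_trajectoryLaw_succ (M : MDP S A) (μ : S → A) (i : S) (n : ℕ) {f : S × ℝ → ℝ}
    (hf : Measurable f) {C : ℝ} (hC : ∀ j, ∀ᵐ z ∂(M.step j (μ j)), |f z| ≤ C) :
    ∫ z, f (z (n + 1)) ∂(M.trajectoryLaw μ i) =
      ∫ z, (∫ y, f y ∂(M.step (z n).1 (μ (z n).1))) ∂(M.trajectoryLaw μ i) := by
  have hm : Measurable fun z : ℕ → S × ℝ => z (n + 1) := by fun_prop
  have hm' : Measurable fun z : ℕ → S × ℝ => (z n).1 := by fun_prop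
  rw [← integral_map (φ := fun z : ℕ → S × ℝ => z (n + 1)) hm.aemeasurable
    hf.aestronglyMeasurable]
  have hint : Integrable f ((M.trajectoryLaw μ i).map (fun z => z (n + 1))) := by
    have := Measure.isProbabilityMeasure_map (μ := M.trajectoryLaw μ i) hm.aemeasurable
    refine Integrable.of_bound hf.aestronglyMeasurable C ?_
    rw [ae_map_iff hm.aemeasurable (measurableSet_le hf.norm measurable_const)]
    exact M.ae_trajectoryLaw_succ μ i n (measurableSet_le hf.norm measurable_const) hC
  rw [M.map_trajectoryLaw_succ] at hint ⊢
  rw [Measure.comp_eq_comp_const_apply] at hint ⊢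
  rw [Kernel.integral_comp hint, Kernel.const_apply, integral_map (f := fun s => ∫ y, f y ∂(M.policyKernel μ s))
    hm'.aemeasurable (measurable_of_finite _).aestronglyMeasurable]
  rfl

/-- The operator `f ↦ P_μ f` averaging over the next state under the policy `μ`. -/
noncomputable def avg (M : MDP S A) (μ : S → A) (f : S → ℝ) (i : S) : ℝ :=
  ∑ j, M.P i (μ i) j * f j

/-- The expectation of a function of the state at time `n` is given by the `n`-th power of the
transition matrix. -/
lemma integral_state (M : MDP S A) (μ : S → A) (i : S) (n : ℕ) (f : S → ℝ) :
    ∫ z, f (z n).1 ∂(M.trajectoryLaw μ i) = (M.avg μ)^[n] f i := by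
  induction n generalizing f with
  | zero =>
    have hm : Measurable fun z : ℕ → S × ℝ => (z 0).1 := by fun_prop
    rw [← integral_map (φ := fun z : ℕ → S × ℝ => (z 0).1) (f := f) hm.aemeasurable
      (measurable_of_finite f).aestronglyMeasurable, map_trajectoryLaw_zero, integral_dirac]
    rfl
  | succ n ih =>
    rw [Function.iterate_succ_apply, ← ih]
    rw [M.integral_trajectoryLaw_succ μ i n (f := fun z => f z.1) (C := ‖f‖)
      ((measurable_of_finite f).comp measurable_fst)
      (fun j => ae_of_all _ fun z => norm_le_pi_norm f z.1)]
    simp only [M.integral_fst_step]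
    rfl

lemma abs_iterate_avg_le (M : MDP S A) (μ : S → A) {f : S → ℝ} {C : ℝ} (hf : ∀ j, |f j| ≤ C)
    (n : ℕ) (i : S) : |(M.avg μ)^[n] f i| ≤ C := by
  induction n generalizing i with
  | zero => exact hf i
  | succ n ih =>
    rw [Function.iterate_succ_apply']
    exact M.abs_sum_P_mul_le i (μ i) _ ih

variable {α : ℝ}

/-- The value function as the Neumann series `∑ α^k P_μ^k g_μ`. -/
lemma value_eq_tsum {M : MDP S A} (hM : M.CostsInUnitInterval) (h0 : 0 < α) (h1 : α < 1)
    (μ : S → A) (i : S) :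
    M.value α μ i = ∑' k : ℕ, α ^ k * (M.avg μ)^[k] (fun j => M.meanCost j (μ j)) i := by
  have hbd : ∀ k, ∀ᵐ z ∂(M.trajectoryLaw μ i), |(z (k + 1)).2| ≤ 1 := fun k =>
    M.ae_trajectoryLaw_succ μ i k (p := fun z => |z.2| ≤ 1)
      (measurableSet_le (by fun_prop) measurable_const)
      fun j => (hM j (μ j)).mono fun z hz => abs_le.2 ⟨by linarith [hz.1], hz.2⟩
  have hbd' : ∀ k, ∀ᵐ z ∂(M.trajectoryLaw μ i), ‖α ^ k * (z (k + 1)).2‖ ≤ α ^ k := fun k => by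
    filter_upwards [hbd k] with z hz
    rw [norm_mul, Real.norm_of_nonneg (pow_nonneg h0.le k)]
    exact mul_le_of_le_one_right (pow_nonneg h0.le k) hz
  have hint : ∀ k : ℕ, Integrable (fun z : ℕ → S × ℝ => α ^ k * (z (k + 1)).2)
      (M.trajectoryLaw μ i) := fun k =>
    Integrable.of_bound ((measurable_snd.comp (measurable_pi_apply (k + 1))).const_mul
      _).aestronglyMeasurable _ (hbd' k)
  have hsum : Summable fun k : ℕ => ∫ z, ‖α ^ k * (z (k + 1)).2‖ ∂(M.trajectoryLaw μ i) := by
    refine Summable.of_nonneg_of_le (fun k => integral_nonneg fun _ => norm_nonneg _) (fun k => ?_)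
      (summable_geometric_of_lt_one h0.le h1)
    have := integral_mono_ae (hint k).norm (integrable_const (α ^ k)) (hbd' k)
    simpa using this
  rw [value, ← (hasSum_integral_of_summable_integral_norm hint hsum).tsum_eq]
  refine tsum_congr fun k => ?_
  rw [integral_const_mul, M.integral_trajectoryLaw_succ μ i k (f := fun z => z.2) measurable_snd
    (C := 1) fun j => (hM j (μ j)).mono fun z hz => abs_le.2 ⟨by linarith [hz.1], hz.2⟩]
  rw [← M.integral_state]
  rfl

/-- The value function of `μ` is a fixed point of `T_μ`. -/
lemma Tpol_value {M : MDP S A} (hM : M.CostsInUnitInterval) (h0 : 0 < α) (h1 : α < 1)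
    (μ : S → A) : M.Tpol α μ (M.value α μ) = M.value α μ := by
  have hs : ∀ i, Summable fun k : ℕ =>
      α ^ k * (M.avg μ)^[k] (fun j => M.meanCost j (μ j)) i := fun i => by
    refine Summable.of_norm_bounded (summable_geometric_of_lt_one h0.le h1) fun k => ?_
    rw [norm_mul, Real.norm_of_nonneg (pow_nonneg h0.le k)]
    exact mul_le_of_le_one_right (pow_nonneg h0.le k)
      (M.abs_iterate_avg_le μ (fun j => M.abs_meanCost_le_one hM j (μ j)) k i)
  ext i
  rw [Tpol, value_eq_tsum hM h0 h1 μ i, (hs i).tsum_eq_zero_add]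
  simp only [pow_zero, one_mul, Function.iterate_zero, id]
  congr 1
  have : ∀ k : ℕ, α ^ (k + 1) * (M.avg μ)^[k + 1] (fun j => M.meanCost j (μ j)) i =
      ∑ j, α * (M.P i (μ i) j *
        (α ^ k * (M.avg μ)^[k] (fun j => M.meanCost j (μ j)) j)) := fun k => by
    rw [Function.iterate_succ_apply', avg, Finset.mul_sum]
    exact Finset.sum_congr rfl fun j _ => by ring
  simp only [this]
  rw [Summable.tsum_finsetSum fun j _ => ((hs j).mul_left _).mul_left _, Finset.mul_sum]
  refine Finset.sum_congr rfl fun j _ => ?_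
  rw [tsum_mul_left, tsum_mul_left, ← value_eq_tsum hM h0 h1]

/-! ### Bellman operators and lookahead policies -/

lemma abs_bellman_sub_le (M : MDP S A) (h0 : 0 < α) (J J' : S → ℝ) (i : S) (u : A) :
    |(M.meanCost i u + α * ∑ j, M.P i u j * J j) -
      (M.meanCost i u + α * ∑ j, M.P i u j * J' j)| ≤ α * ‖J - J'‖ := by
  have : (M.meanCost i u + α * ∑ j, M.P i u j * J j) -
      (M.meanCost i u + α * ∑ j, M.P i u j * J' j) =
      α * ∑ j, M.P i u j * (J - J') j := by
    simp only [Pi.sub_apply, mul_sub, Finset.sum_sub_distrib]; ring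
  rw [this, abs_mul, abs_of_pos h0]
  exact mul_le_mul_of_nonneg_left
    (M.abs_sum_P_mul_le i u _ fun j => norm_le_pi_norm (J - J') j) h0.le

lemma norm_Tpol_sub_le (M : MDP S A) (h0 : 0 < α) (μ : S → A) (J J' : S → ℝ) :
    ‖M.Tpol α μ J - M.Tpol α μ J'‖ ≤ α * ‖J - J'‖ :=
  (pi_norm_le_iff_of_nonneg (by positivity)).2 fun i => M.abs_bellman_sub_le h0 J J' i (μ i)

/-- A function that is almost fixed by `T_μ` is close to the value function of `μ`. -/
lemma norm_value_sub_le {M : MDP S A} (hM : M.CostsInUnitInterval) (h0 : 0 < α) (h1 : α < 1)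
    (μ : S → A) (J : S → ℝ) :
    ‖M.value α μ - J‖ ≤ ‖M.Tpol α μ J - J‖ / (1 - α) := by
  rw [le_div_iff₀ (by linarith)]
  have h := norm_Tpol_sub_le M h0 μ (M.value α μ) J
  have h' := norm_add_le (M.Tpol α μ (M.value α μ) - M.Tpol α μ J) (M.Tpol α μ J - J)
  rw [sub_add_sub_cancel, Tpol_value hM h0 h1] at h'
  rw [Tpol_value hM h0 h1] at h
  linarith

/-- If `J ≤ T_μ J` then `J` is a lower bound for the value of `μ`. -/
lemma le_value_of_le_Tpol {M : MDP S A} (hM : M.CostsInUnitInterval) (h0 : 0 < α) (h1 : α < 1)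
    {μ : S → A} {J : S → ℝ} (h : J ≤ M.Tpol α μ J) : J ≤ M.value α μ := by
  have hle : ∀ n, J ≤ (M.Tpol α μ)^[n] J := fun n => by
    induction n with
    | zero => exact le_rfl
    | succ n ih =>
      rw [Function.iterate_succ_apply']
      exact h.trans (M.Tpol_mono h0 μ ih)
  have hlim : ∀ n, ‖(M.Tpol α μ)^[n] J - M.value α μ‖ ≤ α ^ n * ‖J - M.value α μ‖ := fun n => by
    induction n with
    | zero => simp
    | succ n ih =>
      rw [Function.iterate_succ_apply', pow_succ', mul_assoc]
      nth_rw 1 [← Tpol_value hM h0 h1 μ]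
      exact (M.norm_Tpol_sub_le h0 μ _ _).trans (mul_le_mul_of_nonneg_left ih h0.le)
  intro i
  have h2 : Tendsto (fun n : ℕ => M.value α μ i + α ^ n * ‖J - M.value α μ‖) atTop
      (𝓝 (M.value α μ i + 0 * ‖J - M.value α μ‖)) :=
    ((tendsto_pow_atTop_nhds_zero_of_lt_one h0.le h1).mul_const _).const_add _
  rw [zero_mul, add_zero] at h2
  refine ge_of_tendsto' h2 fun n => ?_
  have h3 := (abs_le.1 ((norm_le_pi_norm _ i).trans (hlim n))).2
  have h4 := hle n i
  rw [Pi.sub_apply] at h3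
  linarith

lemma value_mem_Icc {M : MDP S A} (hM : M.CostsInUnitInterval) (h0 : 0 < α) (h1 : α < 1)
    (μ : S → A) (i : S) : M.value α μ i ∈ Set.Icc 0 (1 / (1 - α)) := by
  have hmc := M.abs_meanCost_le_one hM
  rw [value_eq_tsum hM h0 h1, one_div, ← tsum_geometric_of_lt_one h0.le h1]
  have hnn : ∀ (k : ℕ) (j : S), 0 ≤ (M.avg μ)^[k] (fun j => M.meanCost j (μ j)) j := fun k => by
    induction k with
    | zero => exact fun j => M.meanCost_nonneg hM j (μ j)
    | succ k ih =>
      intro j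
      rw [Function.iterate_succ_apply']
      exact Finset.sum_nonneg fun l _ => mul_nonneg (M.P_nonneg _ _ _) (ih l)
  refine ⟨tsum_nonneg fun k => mul_nonneg (pow_nonneg h0.le k) (hnn k i), ?_⟩
  have hle : ∀ k : ℕ, α ^ k * (M.avg μ)^[k] (fun j => M.meanCost j (μ j)) i ≤ α ^ k := fun k =>
    mul_le_of_le_one_right (pow_nonneg h0.le k)
      ((le_abs_self _).trans (M.abs_iterate_avg_le μ (fun j => hmc j (μ j)) k i))
  have hgeo := summable_geometric_of_lt_one h0.le h1
  exact (Summable.of_nonneg_of_le (fun k => mul_nonneg (pow_nonneg h0.le k) (hnn k i)) hle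
    hgeo).tsum_le_tsum hle hgeo

variable [Fintype A] [Nonempty A]

lemma norm_T_sub_le (M : MDP S A) (h0 : 0 < α) (J J' : S → ℝ) :
    ‖M.T α J - M.T α J'‖ ≤ α * ‖J - J'‖ := by
  have key : ∀ J J' : S → ℝ, ∀ i, M.T α J i - M.T α J' i ≤ α * ‖J - J'‖ := fun J J' i => by
    obtain ⟨μ, hμ⟩ := M.exists_Tpol_eq_T α J'
    have h1 := M.T_le_Tpol α μ J i
    have h2 := (abs_le.1 (M.abs_bellman_sub_le h0 J J' i (μ i))).2
    rw [← hμ]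
    unfold Tpol at h1 ⊢
    linarith
  refine (pi_norm_le_iff_of_nonneg (by positivity)).2 fun i => abs_le.2 ⟨?_, key J J' i⟩
  have := key J' J i
  rw [norm_sub_rev] at this
  rw [Pi.sub_apply]
  linarith

lemma norm_iterate_T_sub_le (M : MDP S A) (h0 : 0 < α) (n : ℕ) (J J' : S → ℝ) :
    ‖(M.T α)^[n] J - (M.T α)^[n] J'‖ ≤ α ^ n * ‖J - J'‖ := by
  induction n with
  | zero => simp
  | succ n ih =>
    rw [Function.iterate_succ_apply', Function.iterate_succ_apply', pow_succ', mul_assoc]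
    exact (M.norm_T_sub_le h0 _ _).trans (mul_le_mul_of_nonneg_left ih h0.le)

/-- The optimal value function solves the Bellman equation: the fixed point of the contraction `T`
is the value of its greedy policy, and lies below the value of every policy. -/
lemma T_optValue {M : MDP S A} (hM : M.CostsInUnitInterval) (h0 : 0 < α) (h1 : α < 1) :
    M.T α (M.optValue α) = M.optValue α := by
  have hc : ContractingWith ⟨α, h0.le⟩ (M.T α) :=
    ⟨h1, LipschitzWith.of_dist_le_mul fun J J' => by
      rw [dist_eq_norm, dist_eq_norm]; exact M.norm_T_sub_le h0 J J'⟩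
  have hfix : M.T α hc.fixedPoint = hc.fixedPoint := hc.fixedPoint_isFixedPt
  suffices h : M.optValue α = hc.fixedPoint by rw [h, hfix]
  obtain ⟨μ, hμ⟩ := M.exists_Tpol_eq_T α hc.fixedPoint
  have hval : M.value α μ = hc.fixedPoint := by
    have := norm_value_sub_le hM h0 h1 μ hc.fixedPoint
    rw [hμ, hfix, sub_self, norm_zero, zero_div] at this
    exact sub_eq_zero.1 (norm_le_zero_iff.1 this)
  ext i
  refine le_antisymm ((ciInf_le (Set.finite_range _).bddBelow μ).trans_eq (congrFun hval i))
    (le_ciInf fun ν => ?_)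
  refine le_value_of_le_Tpol hM h0 h1 ?_ i
  exact hfix.ge.trans (M.T_le_Tpol α ν _)

lemma optValue_mem_Icc {M : MDP S A} (hM : M.CostsInUnitInterval) (h0 : 0 < α) (h1 : α < 1)
    (i : S) : M.optValue α i ∈ Set.Icc 0 (1 / (1 - α)) := by
  obtain ⟨μ, hμ⟩ := exists_eq_ciInf_of_finite (f := fun μ : S → A => M.value α μ i)
  rw [optValue, ← hμ]
  exact value_mem_Icc hM h0 h1 μ i

lemma norm_value_sub_optValue_le {M : MDP S A} (hM : M.CostsInUnitInterval) (h0 : 0 < α)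
    (h1 : α < 1) (μ : S → A) : ‖M.value α μ - M.optValue α‖ ≤ 1 / (1 - α) := by
  have h1' : 0 < 1 - α := by linarith
  refine (pi_norm_le_iff_of_nonneg (by positivity)).2 fun i => ?_
  have h2 := value_mem_Icc hM h0 h1 μ i
  have h3 := optValue_mem_Icc hM h0 h1 i
  exact abs_le.2 ⟨by simp only [Pi.sub_apply]; linarith [h2.1, h3.2],
    by simp only [Pi.sub_apply]; linarith [h2.2, h3.1]⟩

/-- The suboptimality of a lookahead policy, in terms of the Bellman residual `‖T V - V‖`, itself
at most `(1 + α) ‖V - J^*‖`.  One factor `‖V - J^*‖` is kept apart from the residual term, since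
the two are bounded differently in the end. -/
lemma norm_value_sub_optValue_le_of_isLookahead {M : MDP S A} (hM : M.CostsInUnitInterval)
    (h0 : 0 < α) (h1 : α < 1) {H : ℕ} (hH : 1 ≤ H) {V : S → ℝ} {μ : S → A}
    (hμ : M.IsLookahead α H V μ) :
    ‖M.value α μ - M.optValue α‖ ≤ α ^ (H - 1) * ‖V - M.optValue α‖ +
      α ^ (H - 1) * ((1 + α) * ‖V - M.optValue α‖) / (1 - α) := by
  have hfix : (M.T α)^[H - 1] (M.optValue α) = M.optValue α :=
    Function.iterate_fixed (T_optValue hM h0 h1) _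
  have hres : ‖M.T α V - V‖ ≤ (1 + α) * ‖V - M.optValue α‖ := by
    have h2 := M.norm_T_sub_le h0 V (M.optValue α)
    rw [T_optValue hM h0 h1] at h2
    have h3 := norm_sub_le (M.T α V - M.optValue α) (V - M.optValue α)
    rw [sub_sub_sub_cancel_right] at h3
    linarith
  have h4 := norm_value_sub_le hM h0 h1 μ ((M.T α)^[H - 1] V)
  have hH' : (M.T α)^[H] V = (M.T α)^[H - 1] (M.T α V) := by
    rw [← Function.iterate_succ_apply, Nat.succ_eq_add_one, Nat.sub_add_cancel hH]
  rw [hμ, hH'] at h4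
  have h5 : ‖(M.T α)^[H - 1] (M.T α V) - (M.T α)^[H - 1] V‖ ≤
      α ^ (H - 1) * ((1 + α) * ‖V - M.optValue α‖) :=
    (M.norm_iterate_T_sub_le h0 _ _ _).trans (mul_le_mul_of_nonneg_left hres (by positivity))
  have h6 := M.norm_iterate_T_sub_le h0 (H - 1) V (M.optValue α)
  rw [hfix] at h6
  have h7 := norm_add_le (M.value α μ - (M.T α)^[H - 1] V) ((M.T α)^[H - 1] V - M.optValue α)
  rw [sub_add_sub_cancel] at h7
  have h8 := div_le_div_of_nonneg_right h5 (show 0 ≤ 1 - α by linarith)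
  linarith

end MDP

end Dynamics

/-! ### Gradient descent on the least-squares objective -/

section Features

variable {S : Type*} {d : ℕ}

lemma isUnit_gram {Φ : Matrix S (Fin d) ℝ} {D : Finset S} (hrank : (featD Φ D).rank = d) :
    IsUnit ((featD Φ D).transpose * featD Φ D) := by
  rw [← Matrix.mulVec_surjective_iff_isUnit]
  have h : LinearMap.range ((featD Φ D).transpose * featD Φ D).mulVecLin = ⊤ := by
    refine Submodule.eq_top_of_finrank_eq ?_
    have := Matrix.rank_transpose_mul_self (featD Φ D)
    rw [Matrix.rank, hrank] at this
    rw [this]; simp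
  exact LinearMap.range_eq_top.1 h

lemma hasGradientAt_lsCost (Φ : Matrix S (Fin d) ℝ) (D : Finset S) (J : S → ℝ)
    (θ : EuclideanSpace ℝ (Fin d)) :
    HasGradientAt (lsCost Φ D J)
      (∑ i ∈ D, (Φ.mulVec θ.ofLp i - J i) • WithLp.toLp 2 (Φ i)) θ := by
  have hin : ∀ (i : S) (x : EuclideanSpace ℝ (Fin d)),
      Φ.mulVec x.ofLp i = innerSL ℝ (WithLp.toLp 2 (Φ i)) x := fun i x => by
    simp [Matrix.mulVec, dotProduct, PiLp.inner_apply, mul_comm]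
  have h : ∀ i ∈ D, HasFDerivAt
      (fun x : EuclideanSpace ℝ (Fin d) => (Φ.mulVec x.ofLp i - J i) ^ 2)
      ((2 * (Φ.mulVec θ.ofLp i - J i)) • innerSL ℝ (WithLp.toLp 2 (Φ i))) θ := fun i _ => by
    simp only [hin]
    have := ((innerSL ℝ (WithLp.toLp 2 (Φ i))).hasFDerivAt (x := θ)).sub_const (J i) |>.pow 2
    simpa using this
  rw [hasGradientAt_iff_hasFDerivAt]
  convert! (HasFDerivAt.fun_sum h).const_mul (1 / 2 : ℝ) using 1
  ext x
  simp [Finset.mul_sum, mul_assoc]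

variable [Fintype S] [DecidableEq S]

lemma restr_mulVec (D : Finset S) (J : S → ℝ) (i : D) : (restr D).mulVec J i = J i := by
  simp [restr, Matrix.mulVec, dotProduct, Matrix.one_apply]

/-- One step of gradient descent is an affine map with linear part `I - β Φ_Dᵀ Φ_D`. -/
lemma gdIter_succ (Φ : Matrix S (Fin d) ℝ) (D : Finset S) (β : ℝ) (J : S → ℝ) (l : ℕ) :
    gdIter Φ D β J (l + 1) =
      Matrix.toEuclideanCLM (n := Fin d) (𝕜 := ℝ)
        (1 - β • ((featD Φ D).transpose * featD Φ D)) (gdIter Φ D β J l) +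
      WithLp.toLp 2 (β • (featD Φ D).transpose.mulVec ((restr D).mulVec J)) := by
  rw [gdIter, (hasGradientAt_lsCost Φ D J _).gradient]
  generalize gdIter Φ D β J l = θ
  have hsum : (∑ i ∈ D, (Φ.mulVec θ.ofLp i - J i) • WithLp.toLp 2 (Φ i)) =
      WithLp.toLp 2 ((featD Φ D).transpose.mulVec
        ((featD Φ D).mulVec θ.ofLp - (restr D).mulVec J)) := by
    ext m
    simp only [Matrix.mulVec, dotProduct, Matrix.transpose_apply, Pi.sub_apply]
    rw [← Finset.sum_coe_sort D]
    simp only [WithLp.ofLp_sum, WithLp.ofLp_smul, Finset.sum_apply, Pi.smul_apply, smul_eq_mul]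
    refine Finset.sum_congr rfl fun i _ => ?_
    rw [← restr_mulVec D J i]
    simp only [featD, Matrix.submatrix_apply, Matrix.mulVec, dotProduct, id]
    ring
  rw [hsum]
  apply WithLp.ofLp_injective
  simp only [WithLp.ofLp_sub, WithLp.ofLp_add, WithLp.ofLp_smul, Matrix.ofLp_toEuclideanCLM,
    Matrix.mulVec_sub, Matrix.sub_mulVec, Matrix.one_mulVec, Matrix.smul_mulVec,
    Matrix.mulVec_mulVec, smul_sub]
  abel

/-- The least-squares solution `(Φ_Dᵀ Φ_D)⁻¹ Φ_Dᵀ 𝒫 J`. -/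
noncomputable def lsSolution (Φ : Matrix S (Fin d) ℝ) (D : Finset S) :
    (S → ℝ) →ₗ[ℝ] EuclideanSpace ℝ (Fin d) :=
  (WithLp.linearEquiv 2 ℝ (Fin d → ℝ)).symm.toLinearMap ∘ₗ
    (((featD Φ D).transpose * featD Φ D)⁻¹ * (featD Φ D).transpose * restr D).mulVecLin

lemma ofLp_lsSolution (Φ : Matrix S (Fin d) ℝ) (D : Finset S) (J : S → ℝ) :
    (lsSolution Φ D J).ofLp =
      (((featD Φ D).transpose * featD Φ D)⁻¹ * (featD Φ D).transpose * restr D).mulVec J := rfl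

lemma mulVec_lsSolution (Φ : Matrix S (Fin d) ℝ) (D : Finset S) (J : S → ℝ) :
    Φ.mulVec (lsSolution Φ D J).ofLp = (projM Φ D).mulVec J := by
  rw [ofLp_lsSolution, Matrix.mulVec_mulVec, projM]
  simp only [Matrix.mul_assoc]

lemma norm_gdIter_sub_lsSolution_le {Φ : Matrix S (Fin d) ℝ} {D : Finset S}
    (hrank : (featD Φ D).rank = d) (β : ℝ) (J : S → ℝ) (l : ℕ) :
    ‖gdIter Φ D β J l - lsSolution Φ D J‖ ≤
      ‖Matrix.toEuclideanCLM (n := Fin d) (𝕜 := ℝ)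
        (1 - β • ((featD Φ D).transpose * featD Φ D))‖ ^ l * ‖lsSolution Φ D J‖ := by
  induction l with
  | zero => simp [gdIter]
  | succ l ih =>
    have hfix : lsSolution Φ D J = Matrix.toEuclideanCLM (n := Fin d) (𝕜 := ℝ)
        (1 - β • ((featD Φ D).transpose * featD Φ D)) (lsSolution Φ D J) +
        WithLp.toLp 2 (β • (featD Φ D).transpose.mulVec ((restr D).mulVec J)) := by
      apply WithLp.ofLp_injective
      have hG : ((featD Φ D).transpose * featD Φ D) *
          ((featD Φ D).transpose * featD Φ D)⁻¹ = 1 :=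
        Matrix.mul_nonsing_inv _ ((Matrix.isUnit_iff_isUnit_det _).1 (isUnit_gram hrank))
      rw [WithLp.ofLp_add, Matrix.ofLp_toEuclideanCLM, Matrix.sub_mulVec, Matrix.one_mulVec,
        Matrix.smul_mulVec, ofLp_lsSolution]
      rw [Matrix.mulVec_mulVec J (_ * _) (_ * _ * _), Matrix.mul_assoc _ _ (restr D), ← Matrix.mul_assoc _ _⁻¹, hG, Matrix.one_mul,
        ← Matrix.mulVec_mulVec]
      simp
    rw [gdIter_succ, hfix, add_sub_add_right_eq_sub, ← hfix, ← map_sub, pow_succ', mul_assoc]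
    exact (ContinuousLinearMap.le_opNorm _ _).trans
      (mul_le_mul_of_nonneg_left ih (norm_nonneg _))

/-- The values fitted by gradient descent converge geometrically to the least-squares fit,
uniformly over bounded targets. -/
lemma exists_norm_gdIter_sub_projM_le {Φ : Matrix S (Fin d) ℝ} {D : Finset S}
    (hrank : (featD Φ D).rank = d) (β : ℝ) :
    ∃ C : ℝ, 0 ≤ C ∧ ∀ (J : S → ℝ) (l : ℕ),
      ‖Φ.mulVec (gdIter Φ D β J l).ofLp - (projM Φ D).mulVec J‖ ≤
        C * ‖Matrix.toEuclideanCLM (n := Fin d) (𝕜 := ℝ)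
          (1 - β • ((featD Φ D).transpose * featD Φ D))‖ ^ l * ‖J‖ := by
  let F : EuclideanSpace ℝ (Fin d) →L[ℝ] (S → ℝ) := LinearMap.toContinuousLinearMap
    (Φ.mulVecLin ∘ₗ (WithLp.linearEquiv 2 ℝ (Fin d → ℝ)).toLinearMap)
  let K : (S → ℝ) →L[ℝ] EuclideanSpace ℝ (Fin d) :=
    LinearMap.toContinuousLinearMap (lsSolution Φ D)
  refine ⟨‖F‖ * ‖K‖, by positivity, fun J l => ?_⟩
  have h1 : Φ.mulVec (gdIter Φ D β J l).ofLp - (projM Φ D).mulVec J =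
      F (gdIter Φ D β J l - lsSolution Φ D J) := by
    rw [← mulVec_lsSolution, map_sub]; rfl
  have h2 : ‖lsSolution Φ D J‖ ≤ ‖K‖ * ‖J‖ := K.le_opNorm J
  rw [h1]
  refine (F.le_opNorm _).trans ?_
  rw [mul_assoc, mul_assoc]
  refine mul_le_mul_of_nonneg_left ?_ (norm_nonneg _)
  refine (norm_gdIter_sub_lsSolution_le hrank β J l).trans ?_
  rw [mul_left_comm]
  exact mul_le_mul_of_nonneg_left h2 (by positivity)

lemma norm_projM_mulVec_sub_le_delta2 {A : Type*} [Finite A] [MeasurableSpace S]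
    [MeasurableSingletonClass S] (M : MDP S A) (α : ℝ) (Φ : Matrix S (Fin d) ℝ) (D : Finset S)
    (μ : S → A) :
    ‖(projM Φ D).mulVec (M.value α μ) - M.value α μ‖ ≤ delta2 M α Φ D :=
  le_ciSup (f := fun μ : S → A => ‖(projM Φ D).mulVec (M.value α μ) - M.value α μ‖)
    (Set.finite_range _).bddAbove μ

end Features

/-! ### Averaging recursions -/

/-- An averaging recursion `a_{k+1} ≤ (1 - γ_k) a_k + γ_k b` with divergent step sizes forgets its
initial value. -/
lemma eventually_lt_of_averaging {a γ : ℕ → ℝ} {b B : ℝ} (hbB : b < B)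
    (hγ : Tendsto (fun n => ∑ k ∈ Finset.range n, γ k) atTop atTop)
    (hγ1 : ∀ᶠ k in atTop, γ k ≤ 1)
    (ha : ∀ᶠ k in atTop, a (k + 1) ≤ (1 - γ k) * a k + γ k * b) :
    ∀ᶠ k in atTop, a k < B := by
  obtain ⟨N, hN⟩ := eventually_atTop.1 (hγ1.and ha)
  have key : ∀ n, N ≤ n → max (a n - b) 0 ≤ max (a N - b) 0 *
      Real.exp (∑ k ∈ Finset.range N, γ k - ∑ k ∈ Finset.range n, γ k) := by
    intro n hn
    induction n, hn using Nat.le_induction with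
    | base => simp
    | succ n hn ih =>
      obtain ⟨h1, h2⟩ := hN n hn
      have h3 : max (a (n + 1) - b) 0 ≤ (1 - γ n) * max (a n - b) 0 := by
        refine max_le ?_ (mul_nonneg (by linarith) (le_max_right _ _))
        have := mul_le_mul_of_nonneg_left (le_max_left (a n - b) 0)
          (show 0 ≤ 1 - γ n by linarith)
        linarith
      have h4 : 1 - γ n ≤ Real.exp (-γ n) := Real.one_sub_le_exp_neg _
      rw [Finset.sum_range_succ, ← sub_sub, sub_eq_add_neg _ (γ n), Real.exp_add]
      calc max (a (n + 1) - b) 0 ≤ (1 - γ n) * max (a n - b) 0 := h3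
        _ ≤ Real.exp (-γ n) * _ :=
            mul_le_mul h4 ih (le_max_right _ _) (Real.exp_pos _).le
        _ = _ := by ring
  have hlim : Tendsto (fun n => max (a N - b) 0 *
      Real.exp (∑ k ∈ Finset.range N, γ k - ∑ k ∈ Finset.range n, γ k)) atTop (𝓝 0) := by
    have h : Tendsto (fun n => ∑ k ∈ Finset.range N, γ k - ∑ k ∈ Finset.range n, γ k)
        atTop atBot := by
      simp only [sub_eq_add_neg]
      exact tendsto_atBot_add_const_left _ _ (tendsto_neg_atTop_atBot.comp hγ)
    simpa using (Real.tendsto_exp_atBot.comp h).const_mul (max (a N - b) 0)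
  filter_upwards [hlim.eventually_lt_const (sub_pos.2 hbB), eventually_ge_atTop N] with n h1 h2
  have := (le_max_left _ _).trans (key n h2)
  linarith

/-! ### Convergence of the weighted noise -/

section Noise

variable {Ω : Type*} {mΩ : MeasurableSpace Ω} {Pr : Measure Ω} [IsProbabilityMeasure Pr]
  {ℱ : Filtration ℕ mΩ} {ξ : ℕ → Ω → ℝ} {C : ℝ} {γ : ℕ → ℝ}

/-- Bounded martingale differences with square-summable weights have an almost surely convergent
sum: the partial sums are a martingale, bounded in `L²` by orthogonality of the increments. -/
lemma ae_exists_tendsto_sum_mul (hξ : ∀ k, Measurable[ℱ (k + 1)] (ξ k))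
    (hmean : ∀ k, Pr[ξ k | ℱ k] =ᵐ[Pr] 0) (hbdd : ∀ k, ∀ᵐ ω ∂Pr, |ξ k ω| ≤ C)
    (hγ : Summable fun k => γ k ^ 2) :
    ∀ᵐ ω ∂Pr, ∃ c, Tendsto (fun n => ∑ k ∈ Finset.range n, γ k * ξ k ω) atTop (𝓝 c) := by
  set X : ℕ → Ω → ℝ := fun n ω => ∑ k ∈ Finset.range n, γ k * ξ k ω with hX
  have hξm : ∀ k, Measurable (ξ k) := fun k => (hξ k).mono (ℱ.le _) le_rfl
  have hXm : ∀ n, StronglyMeasurable[ℱ n] (X n) := fun n =>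
    (Finset.measurable_fun_sum _ fun k hk =>
      ((hξ k).mono (ℱ.mono (Finset.mem_range.1 hk)) le_rfl).const_mul _).stronglyMeasurable
  have hξL : ∀ k, MemLp (ξ k) 2 Pr := fun k =>
    MemLp.of_bound (hξm k).aestronglyMeasurable C (hbdd k)
  have hXL : ∀ n, MemLp (X n) 2 Pr := fun n =>
    memLp_finsetSum _ fun k _ => (hξL k).const_mul (γ k)
  have hXint : ∀ n, Integrable (X n) Pr := fun n => (hXL n).integrable one_le_two
  have hξint : ∀ n, Integrable (ξ n) Pr := fun n => (hξL n).integrable one_le_two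
  have hstep : ∀ n, X (n + 1) = X n + γ n • ξ n := fun n => by
    ext ω; simp [hX, Finset.sum_range_succ]
  have hmart : Martingale X ℱ Pr := by
    refine martingale_of_condExp_sub_eq_zero_nat hXm hXint fun n => ?_
    rw [hstep, add_sub_cancel_left]
    filter_upwards [condExp_smul (γ n) (ξ n) (ℱ n) (μ := Pr), hmean n] with ω h1 h2
    rw [h1, Pi.smul_apply, h2]; simp
  have horth : ∀ n, ∫ ω, X n ω * ξ n ω ∂Pr = 0 := fun n => by
    have hprod : Integrable (X n * ξ n) Pr := (hXL n).integrable_mul (hξL n)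
    have h := condExp_mul_of_stronglyMeasurable_left (hXm n) hprod (hξint n)
    change ∫ ω, (X n * ξ n) ω ∂Pr = 0
    rw [← integral_condExp (ℱ.le n)]
    refine integral_eq_zero_of_ae ?_
    filter_upwards [h, hmean n] with ω h1 h2
    rw [h1, Pi.mul_apply, h2]; simp
  have hsq : ∀ n, ∫ ω, X n ω ^ 2 ∂Pr ≤ C ^ 2 * ∑ k ∈ Finset.range n, γ k ^ 2 := by
    intro n
    induction n with
    | zero => simp [hX]
    | succ n ih =>
      have h1 : ∫ ω, ξ n ω ^ 2 ∂Pr ≤ C ^ 2 := by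
        have := integral_mono_ae (hξL n).integrable_sq (integrable_const (C ^ 2))
          ((hbdd n).mono fun ω h => sq_le_sq' (by linarith [abs_le.1 h]) (abs_le.1 h).2)
        simpa using this
      have h2 : ∀ ω, X (n + 1) ω ^ 2 =
          X n ω ^ 2 + 2 * γ n * (X n ω * ξ n ω) + γ n ^ 2 * ξ n ω ^ 2 := fun ω => by
        rw [hstep]; simp only [Pi.add_apply, Pi.smul_apply, smul_eq_mul]; ring
      have hprod : Integrable (fun ω => X n ω * ξ n ω) Pr := (hXL n).integrable_mul (hξL n)
      simp only [h2]
      rw [integral_add (f := fun ω => X n ω ^ 2 + 2 * γ n * (X n ω * ξ n ω))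
        ((hXL n).integrable_sq.add (hprod.const_mul _)) ((hξL n).integrable_sq.const_mul _),
        integral_add (hXL n).integrable_sq
        (hprod.const_mul _), integral_const_mul, integral_const_mul, horth,
        Finset.sum_range_succ]
      have := mul_le_mul_of_nonneg_left h1 (sq_nonneg (γ n))
      linarith
  refine hmart.submartingale.exists_ae_tendsto_of_bdd
    (R := (1 + C ^ 2 * ∑' k, γ k ^ 2).toNNReal) fun n => ?_
  rw [eLpNorm_one_eq_lintegral_enorm, ← ofReal_integral_norm_eq_lintegral_enorm (hXint n)]
  refine ENNReal.ofReal_le_ofReal ?_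
  have h1 : ∫ ω, ‖X n ω‖ ∂Pr ≤ ∫ ω, (1 + X n ω ^ 2) ∂Pr := by
    refine integral_mono (hXint n).norm ((integrable_const _).add (hXL n).integrable_sq)
      fun ω => ?_
    have := sq_nonneg (|X n ω| - 1)
    rw [sub_sq, sq_abs] at this
    simp only [Real.norm_eq_abs]
    nlinarith [abs_nonneg (X n ω)]
  rw [integral_add (integrable_const _) (hXL n).integrable_sq] at h1
  have h2 := mul_le_mul_of_nonneg_left (hγ.sum_le_tsum (Finset.range n) fun k _ => sq_nonneg (γ k))
    (sq_nonneg C)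
  simp only [integral_const, probReal_univ, smul_eq_mul, mul_one] at h1
  linarith [hsq n]

end Noise

/-! ### Convergence of the algorithm -/

section Run

variable {S A : Type*} [Fintype S] [DecidableEq S] [MeasurableSpace S]
  [MeasurableSingletonClass S] [Fintype A] {M : MDP S A} {α : ℝ} {H d : ℕ}
  {Φ : Matrix S (Fin d) ℝ} {D : Finset S} {γ : ℕ → ℝ} {η : ℕ → ℕ} {β : ℝ} {V0 : S → ℝ}
  {w : ℕ → S → ℝ} {pol : ℕ → S → A} {V : ℕ → S → ℝ}

/-- Along a run with bounded noise whose weighted sum converges, the iterates are, up to a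
vanishing correction `r`, an exact average `U = V - r` of least-squares fits of the values of the
policies, up to a vanishing error `e`.  The correction is `𝓜` applied to minus the tail of the
series `∑ γ_k w_k`. -/
lemma IsGDRun.exists_vanishing_correction (hM : M.CostsInUnitInterval) (h0 : 0 < α) (h1 : α < 1)
    (hrank : (featD Φ D).rank = d) (hη : Tendsto η atTop atTop)
    (hβ : ‖Matrix.toEuclideanCLM (n := Fin d) (𝕜 := ℝ)
      (1 - β • ((featD Φ D).transpose * featD Φ D))‖ < 1)
    (hrun : IsGDRun M α H Φ D β γ η V0 w pol V)
    {C : ℝ} (hw : ∀ k, ‖w k‖ ≤ C) {s : S → ℝ}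
    (hs : Tendsto (fun n => ∑ k ∈ Finset.range n, γ k • w k) atTop (𝓝 s)) :
    ∃ r e : ℕ → S → ℝ, Tendsto r atTop (𝓝 0) ∧ Tendsto e atTop (𝓝 0) ∧
      ∀ k, V (k + 1) - r (k + 1) = (1 - γ k) • (V k - r k) +
        γ k • ((projM Φ D).mulVec (M.value α (pol k)) + e k) := by
  set r : ℕ → S → ℝ := fun n =>
    (projM Φ D).mulVec (∑ k ∈ Finset.range n, γ k • w k - s) with hr
  set e : ℕ → S → ℝ := fun k =>
    Φ.mulVec (gdIter Φ D β (M.value α (pol k) + w k) (η k)).ofLp -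
      (projM Φ D).mulVec (M.value α (pol k) + w k) with he
  have hr0 : Tendsto r atTop (𝓝 0) := by
    have h := ((projM Φ D).mulVecLin.continuous_of_finiteDimensional.tendsto 0).comp
      (tendsto_sub_nhds_zero_iff.2 hs)
    simpa [hr, Function.comp_def] using h
  have he0 : Tendsto e atTop (𝓝 0) := by
    obtain ⟨K, hK0, hK⟩ := exists_norm_gdIter_sub_projM_le hrank β
    set ρ := ‖Matrix.toEuclideanCLM (n := Fin d) (𝕜 := ℝ)
      (1 - β • ((featD Φ D).transpose * featD Φ D))‖
    have hbd : ∀ k, ‖e k‖ ≤ K * ρ ^ η k * (1 / (1 - α) + C) := fun k => by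
      have h1' : 0 < 1 - α := by linarith
      refine (hK _ _).trans (mul_le_mul_of_nonneg_left ((norm_add_le _ _).trans
        (add_le_add ?_ (hw k))) (by positivity))
      refine (pi_norm_le_iff_of_nonneg (by positivity)).2 fun i => ?_
      have := MDP.value_mem_Icc hM h0 h1 (pol k) i
      rw [Real.norm_of_nonneg this.1]
      exact this.2
    refine squeeze_zero_norm hbd ?_
    have h := (tendsto_pow_atTop_nhds_zero_of_lt_one (norm_nonneg _) hβ).comp hη
    have h2 := (h.const_mul K).mul_const (1 / (1 - α) + C)
    rwa [mul_zero, zero_mul] at h2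
  refine ⟨r, fun k => e k - r k, hr0, by simpa using he0.sub hr0, fun k => ?_⟩
  have hstep : r (k + 1) = r k + γ k • (projM Φ D).mulVec (w k) := by
    simp only [hr]
    rw [Finset.sum_range_succ, add_sub_right_comm, Matrix.mulVec_add, Matrix.mulVec_smul]
  rw [hrun.update, hstep]
  simp only [he]
  rw [Matrix.mulVec_add]
  module

/-- For a noise realization that is bounded and has a convergent weighted sum, the run satisfies
the asymptotic error bound. -/
lemma IsGDRun.eventually_norm_sub_optValue_lt [Nonempty A] (hM : M.CostsInUnitInterval) (h0 : 0 < α)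
    (h1 : α < 1) (hH : 2 ≤ H) (hrank : (featD Φ D).rank = d) (hγ0 : ∀ k, 0 ≤ γ k)
    (hγ1 : Tendsto (fun n => ∑ k ∈ Finset.range n, γ k) atTop atTop)
    (hγ2 : Summable (fun k => γ k ^ 2)) (hη : Tendsto η atTop atTop)
    (hβ : ‖Matrix.toEuclideanCLM (n := Fin d) (𝕜 := ℝ)
      (1 - β • ((featD Φ D).transpose * featD Φ D))‖ < 1)
    (hrun : IsGDRun M α H Φ D β γ η V0 w pol V)
    {C : ℝ} (hw : ∀ k, ‖w k‖ ≤ C) {s : S → ℝ}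
    (hs : Tendsto (fun n => ∑ k ∈ Finset.range n, γ k • w k) atTop (𝓝 s))
    {B : ℝ} (hB : 1 / (1 - α ^ (H - 1)) * (delta2 M α Φ D +
      α ^ (H - 1) * ((1 + α) * (delta2 M α Φ D + 1 / (1 - α))) / (1 - α)) < B) :
    ∀ᶠ k in atTop, ‖V k - M.optValue α‖ < B := by
  obtain ⟨r, e, hr, he, hU⟩ := hrun.exists_vanishing_correction hM h0 h1 hrank hη hβ hw hs
  set δ := delta2 M α Φ D
  set q := α ^ (H - 1)
  have hα : 0 < 1 - α := by linarith
  have hq0 : 0 < q := pow_pos h0 _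
  have hq1 : q < 1 := pow_lt_one₀ h0.le h1 (by omega)
  have hq : 0 < 1 - q := by linarith
  have hγle : ∀ᶠ k in atTop, γ k ≤ 1 := by
    filter_upwards [hγ2.tendsto_atTop_zero.eventually_lt_const one_pos] with k hk
    exact (abs_le.1 ((sq_le_one_iff_abs_le_one _).1 hk.le)).2
  set a : ℕ → ℝ := fun k => ‖V k - r k - M.optValue α‖ with ha
  have hVa : ∀ k, ‖V k - M.optValue α‖ ≤ a k + ‖r k‖ := fun k => by
    have := norm_add_le (V k - r k - M.optValue α) (r k)
    rwa [show V k - r k - M.optValue α + r k = V k - M.optValue α by abel] at this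
  have hstep : ∀ k, γ k ≤ 1 → a (k + 1) ≤ (1 - γ k) * a k +
      γ k * (δ + ‖M.value α (pol k) - M.optValue α‖ + ‖e k‖) := fun k hk => by
    have h2 : V (k + 1) - r (k + 1) - M.optValue α = (1 - γ k) • (V k - r k - M.optValue α) +
        γ k • (((projM Φ D).mulVec (M.value α (pol k)) - M.value α (pol k)) +
          (M.value α (pol k) - M.optValue α) + e k) := by
      rw [hU]; module
    have h3 := norm_projM_mulVec_sub_le_delta2 M α Φ D (pol k)
    simp only [ha]
    rw [h2]
    refine (norm_add_le _ _).trans ?_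
    rw [norm_smul, norm_smul, Real.norm_of_nonneg (hγ0 k),
      Real.norm_of_nonneg (show 0 ≤ 1 - γ k by linarith)]
    refine add_le_add_right (mul_le_mul_of_nonneg_left ((norm_add₃_le).trans ?_) (hγ0 k)) _
    linarith
  have hr' : Tendsto (fun k => ‖r k‖) atTop (𝓝 0) := by simpa using hr.norm
  have he' : Tendsto (fun k => ‖e k‖) atTop (𝓝 0) := by simpa using he.norm
  -- The crude bound: both value functions lie in `[0, 1/(1-α)]`.
  have hcrude : ∀ ε > 0, ∀ᶠ k in atTop, ‖V k - M.optValue α‖ < δ + 1 / (1 - α) + ε := by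
    intro ε hε
    have hav := eventually_lt_of_averaging (a := a) (b := δ + 1 / (1 - α) + ε / 4)
      (B := δ + 1 / (1 - α) + ε / 2) (by linarith) hγ1 hγle (by
        filter_upwards [hγle, he'.eventually_lt_const (show 0 < ε / 4 by linarith)] with k h2 h3
        refine (hstep k h2).trans (add_le_add_right (mul_le_mul_of_nonneg_left ?_ (hγ0 k)) _)
        have := MDP.norm_value_sub_optValue_le hM h0 h1 (pol k)
        linarith)
    filter_upwards [hav, hr'.eventually_lt_const (show 0 < ε / 2 by linarith)] with k h2 h3
    linarith [hVa k]
  -- The crude bound is used for the Bellman residual only; the remaining term contracts by `q`.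
  set c := q * (1 + α) / (1 - α)
  have hc : 0 ≤ c := by positivity
  set B₀ := 1 / (1 - q) * (δ + q * ((1 + α) * (δ + 1 / (1 - α))) / (1 - α)) with hB₀
  have hB₀' : (1 - q) * B₀ = δ + c * (δ + 1 / (1 - α)) := by
    simp only [hB₀, c]; field_simp
  -- The slack `(1-q) ((B₀+B)/2 - B₀)` of the averaging target is `3 ε`, one `ε` for each of the
  -- vanishing terms: `e k`, `q ‖r k‖`, and the excess over the crude bound.
  set ε := (1 - q) * (B - B₀) / 6 with hε
  have hεpos : 0 < ε := by have := sub_pos.2 hB; positivity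
  have hav := eventually_lt_of_averaging (a := a) (γ := fun k => (1 - q) * γ k)
    (b := (B₀ + B) / 2) (B := (B₀ + 2 * B) / 3) (by linarith)
    (by simpa only [← Finset.mul_sum] using hγ1.const_mul_atTop hq)
    (by
      filter_upwards [hγle] with k hk
      nlinarith [hγ0 k])
    (by
      filter_upwards [hγle, he'.eventually_lt_const hεpos, hr'.eventually_lt_const hεpos,
        hcrude (ε / (c + 1)) (by positivity)] with k h2 h3 h4 h5
      have h6 := MDP.norm_value_sub_optValue_le_of_isLookahead hM h0 h1 (by omega)
        (hrun.lookahead k)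
      have h7 : q * ((1 + α) * ‖V k - M.optValue α‖) / (1 - α) = c * ‖V k - M.optValue α‖ := by
        simp only [c]; ring
      have h8 := mul_le_mul_of_nonneg_left h5.le hc
      have h9 : c * (ε / (c + 1)) ≤ ε := by
        rw [mul_div_left_comm]
        exact mul_le_of_le_one_right hεpos.le ((div_le_one (by linarith)).2 (by linarith))
      have h10 := mul_le_mul_of_nonneg_left (hVa k) hq0.le
      have h11 : q * ‖r k‖ ≤ ‖r k‖ := mul_le_of_le_one_left (norm_nonneg _) hq1.le
      have h12 : δ + ‖M.value α (pol k) - M.optValue α‖ + ‖e k‖ ≤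
          q * a k + (1 - q) * ((B₀ + B) / 2) := by
        have : (1 - q) * ((B₀ + B) / 2) = (1 - q) * B₀ + 3 * ε := by rw [hε]; ring
        rw [this, hB₀']
        linarith
      have h13 := mul_le_mul_of_nonneg_left h12 (hγ0 k)
      have h14 := hstep k h2
      linarith)
  filter_upwards [hav, hr'.eventually_lt_const (show 0 < (B - B₀) / 3 by linarith)] with k h2 h3
  linarith [hVa k]

end Run

end LookaheadGD

theorem theorem2
    {S A Ω : Type*} [Fintype S] [DecidableEq S] [MeasurableSpace S] [MeasurableSingletonClass S]
    [Fintype A] [Nonempty A]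
    -- the MDP, with random costs in [0,1], and the discount factor
    (M : LookaheadGD.MDP S A) (hcost : M.CostsInUnitInterval)
    (α : ℝ) (hα0 : 0 < α) (hα1 : α < 1)
    -- amount of lookahead
    (H : ℕ) (hH : 2 ≤ H)
    -- feature vectors (the rows of Φ) and the set D of evaluated states
    {d : ℕ} (Φ : Matrix S (Fin d) ℝ) (D : Finset S)
    (hrank : (LookaheadGD.featD Φ D).rank = d)
    -- outer step sizes
    (γ : ℕ → ℝ) (hγ0 : ∀ k, 0 ≤ γ k)
    (hγ1 : Tendsto (fun n => ∑ k ∈ Finset.range n, γ k) atTop atTop)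
    (hγ2 : Summable (fun k => γ k ^ 2))
    -- number of gradient steps
    (η : ℕ → ℕ) (hη : Tendsto η atTop atTop)
    -- gradient step size; the norm is the spectral norm
    (β : ℝ)
    (hβ : ‖Matrix.toEuclideanCLM (n := Fin d) (𝕜 := ℝ)
      (1 - β • ((LookaheadGD.featD Φ D).transpose * LookaheadGD.featD Φ D))‖ < 1)
    -- noise: w k is revealed after time k, is unbiased given the past, and is bounded
    [mΩ : MeasurableSpace Ω] (Pr : Measure Ω) [IsProbabilityMeasure Pr]
    (ℱ : Filtration ℕ mΩ) (w : ℕ → Ω → S → ℝ)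
    (hw_adapted : ∀ k, Measurable[ℱ (k + 1)] (w k))
    (hw_mean : ∀ k i, Pr[fun ω => w k ω i | ℱ k] =ᵐ[Pr] fun _ => 0)
    (hw_norm : ∀ k, Pr[fun ω => ‖w k ω‖ | ℱ k] ≤ᵐ[Pr] fun _ => 1 / (1 - α))
    (C_w : ℝ) (hw_bdd : ∀ k, ∀ᵐ ω ∂Pr, ‖w k ω‖ ≤ C_w)
    -- the algorithm: the policy pol k, chosen from V k, may not anticipate the noise w k
    (V0 : S → ℝ) (pol : ℕ → Ω → S → A) (V : ℕ → Ω → S → ℝ)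
    (hpol : ∀ k (p : S → A), MeasurableSet[ℱ k] {ω | pol k ω = p})
    (hrun : ∀ ω, LookaheadGD.IsGDRun M α H Φ D β γ η V0
      (fun k => w k ω) (fun k => pol k ω) (fun k => V k ω)) :
    ∀ᵐ ω ∂Pr,
      limsup (fun k => ((‖V k ω - M.optValue α‖ : ℝ) : EReal)) atTop ≤
        ((1 / (1 - α ^ (H - 1)) *
          (LookaheadGD.delta2 M α Φ D +
            α ^ (H - 1) * ((1 + α) * (LookaheadGD.delta2 M α Φ D + 1 / (1 - α))) / (1 - α)) : ℝ) :
          EReal) := by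
  have hconv : ∀ i, ∀ᵐ ω ∂Pr, ∃ c, Tendsto
      (fun n => ∑ k ∈ Finset.range n, γ k * w k ω i) atTop (nhds c) := fun i =>
    LookaheadGD.ae_exists_tendsto_sum_mul (ℱ := ℱ) (C := C_w)
      (fun k => (measurable_pi_apply i).comp (hw_adapted k)) (fun k => hw_mean k i)
      (fun k => (hw_bdd k).mono fun ω h => (norm_le_pi_norm (w k ω) i).trans h) hγ2
  filter_upwards [ae_all_iff.2 hconv, ae_all_iff.2 hw_bdd] with ω hω hbd
  choose s hs using hω
  have hs' : Tendsto (fun n => ∑ k ∈ Finset.range n, γ k • w k ω) atTop (nhds s) :=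
    tendsto_pi_nhds.2 fun i => by simpa using hs i
  refine EReal.le_of_forall_lt_iff_le.1 fun B hB => ?_
  refine limsup_le_of_le (by isBoundedDefault) ?_
  filter_upwards [(hrun ω).eventually_norm_sub_optValue_lt hcost hα0 hα1 hH hrank hγ0 hγ1 hγ2 hη
    hβ hbd hs' (EReal.coe_lt_coe_iff.1 hB)] with k hk
  exact EReal.coe_le_coe_iff.2 hk.le
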